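/- Let $B=(B_t)_{t\ge 0}$ be a fractional Brownian motion with Hurst index $H\in(0,1)$ on a probability space $(\Omega,\mathcal F,P)$, that is, a real-valued continuous centered Gaussian process with $E(B_tB_s)=\frac12\big(s^{2H}+t^{2H}-|t-s|^{2H}\big)$ for all $s,t\ge 0$. Let $H^*$ be a real number with $H\le H^*<1$. Fix an integer $n\ge 1$ and a real number $a$ with $0<a<(4-4^{H^*})\sqrt n$, and set $$S_n=\sum_{k=0}^{n-1}\Big(B_{\frac{k+2}{n}}-2B_{\frac{k+1}{n}}+B_{\frac kn}\Big)^2,\qquad g_n(x)=x-\frac{\log(4-4^x)}{2\log n}\quad(0<x<1).$$ Then, with probability at least $$\varphi(a)=\left[1-2\exp\left(-\frac{a^2}{71\left(\frac{a}{\sqrt n}+3\right)}\right)\right]_+,$$ where $[x]_+=\max(x,0)$, the quantity $g_n(H)$ belongs to the interval $$I(n)=\left[\frac12-\frac{\log S_n}{2\log n}+\frac{\log\left(1-\frac{a}{(4-4^{H^*})\sqrt n}\right)}{2\log n}\,;\ \frac12-\frac{\log S_n}{2\log n}+\frac{\log\left(1+\frac{a}{(4-4^{H^*})\sqrt n}\right)}{2\log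 n}\right].$$ (For $n=1$ the quotients by $\log n=0$ are read as $0$; then $\varphi(a)=0$ and the claim is void.) -/

import Mathlib

open MeasureTheory ProbabilityTheory
open scoped NNReal

/-- The process `B`, indexed by the times `t ≥ 0`, is a fractional Brownian motion with Hurst
index `H` under `P`: a centered Gaussian process with almost surely continuous paths and
`E[B_s B_t] = (s ^ (2H) + t ^ (2H) - |t - s| ^ (2H)) / 2`. -/
structure IsFractionalBrownianMotion {Ω : Type*} {mΩ : MeasurableSpace Ω}
    (H : ℝ) (B : ℝ≥0 → Ω → ℝ) (P : Measure Ω) : Prop where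
  isGaussianProcess : IsGaussianProcess B P
  centered : ∀ t : ℝ≥0, ∫ ω, B t ω ∂P = 0
  covariance : ∀ s t : ℝ≥0, ∫ ω, B s ω * B t ω ∂P =
    1 / 2 * ((s : ℝ) ^ (2 * H) + (t : ℝ) ^ (2 * H) - |(t : ℝ) - (s : ℝ)| ^ (2 * H))
  continuous_paths : ∀ᵐ ω ∂P, Continuous fun t : ℝ≥0 => B t ω

noncomputable section

/-- The sum `S_n` of the squared second-order increments of `B` sampled at the times `k / n`,
`k = 0, …, n + 1`. -/
def secondOrderVariation {Ω : Type*} (B : ℝ≥0 → Ω → ℝ) (n : ℕ) (ω : Ω) : ℝ :=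
  ∑ k ∈ Finset.range n,
    (B (((k : ℝ≥0) + 2) / (n : ℝ≥0)) ω - 2 * B (((k : ℝ≥0) + 1) / (n : ℝ≥0)) ω
      + B ((k : ℝ≥0) / (n : ℝ≥0)) ω) ^ 2

/-- The function `g_n(x) = x - log (4 - 4 ^ x) / (2 log n)`. -/
def hurstTransform (n : ℕ) (x : ℝ) : ℝ :=
  x - Real.log (4 - (4 : ℝ) ^ x) / (2 * Real.log n)

/-- The left endpoint `I_l(n)` of the confidence interval, as a function of the observed value
`S` of `S_n`, the known bound `Hstar` on the Hurst index, and the parameter `a`. -/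
def confidenceLeft (n : ℕ) (Hstar a S : ℝ) : ℝ :=
  1 / 2 - Real.log S / (2 * Real.log n)
    + Real.log (1 - a / ((4 - (4 : ℝ) ^ Hstar) * √(n : ℝ))) / (2 * Real.log n)

/-- The right endpoint `I_r(n)` of the confidence interval. -/
def confidenceRight (n : ℕ) (Hstar a S : ℝ) : ℝ :=
  1 / 2 - Real.log S / (2 * Real.log n)
    + Real.log (1 + a / ((4 - (4 : ℝ) ^ Hstar) * √(n : ℝ))) / (2 * Real.log n)

/-- The confidence level `φ(a) = [1 - 2 exp (-a² / (71 (a / √n + 3)))]₊`. -/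
def confidenceLevel (n : ℕ) (a : ℝ) : ℝ :=
  max (1 - 2 * Real.exp (-(a ^ 2 / (71 * (a / √(n : ℝ) + 3))))) 0

end

/-! After multiplication by `n ^ (2H)`, the variation `S_n` is the squared norm of a centered
Gaussian vector with Toeplitz covariance matrix `A`, whose trace is `n (4 - 4 ^ H)`. In an
orthonormal eigenbasis of `A` it becomes a sum of squares of independent Gaussians, and a Chernoff
argument gives `P(|sum - trace| ≥ x) ≤ 2 exp (-x² / (4 L (x + M)))` when `L` bounds the eigenvalues
and `M` the trace (`measureReal_abs_sum_sq_sub_ge_le`).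

By Gershgorin, `L` may be any bound on the absolute row sums. A bound free of `n` and `H` exists
because covariances at lags at least 2 are fourth differences of `x ^ (2H)`, which have constant
sign, so their absolute values telescope (`sum_abs_secondOrderCov_sub_le`).

With `x = a √n` and `M = 3n` this is the stated level. Off the exceptional event, taking logarithms
of the two-sided bound on `S_n` encloses `g_n(H)` (`hurstTransform_mem_Icc`). -/

/-! ### Signs of iterated differences of powers. -/

/-- Forward differences commute with differentiation of a real power. -/
lemma hasDerivAt_fwdDiff_iter_rpow (q : ℝ) (k : ℕ) {x : ℝ} (hx : 0 < x) :
    HasDerivAt ((fwdDiff (1 : ℝ))^[k] fun y : ℝ => y ^ q)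
      (q * (fwdDiff (1 : ℝ))^[k] (fun y : ℝ => y ^ (q - 1)) x) x := by
  induction k generalizing x with
  | zero => simpa using Real.hasDerivAt_rpow_const (p := q) (Or.inl hx.ne')
  | succ k ih =>
    simp only [Function.iterate_succ_apply']
    have h1 := (ih (x := x + 1) (by linarith)).comp_add_const x 1
    have h := h1.sub (ih hx)
    rw [← mul_sub] at h
    exact h

/-- Differences inherit the sign of the `k`-th derivative. Inductively, the order `k` difference of
`y ^ q`, weighted by the product of length `k + 1`, has derivative `q ^ 2` times the nonnegative
quantity for `q - 1`; hence it is monotone and its unit increment is nonnegative. -/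
lemma fwdDiff_iter_rpow_sign_of_pos (q : ℝ) (k : ℕ) {x : ℝ} (hx : 0 < x) :
    0 ≤ (∏ i ∈ Finset.range k, (q - i)) * (fwdDiff (1 : ℝ))^[k] (fun y : ℝ => y ^ q) x := by
  induction k generalizing q x with
  | zero => simpa using Real.rpow_nonneg hx.le q
  | succ k ih =>
    set c := ∏ i ∈ Finset.range (k + 1), (q - (i : ℕ)) with hc
    have hc' : c = q * ∏ i ∈ Finset.range k, (q - 1 - (i : ℕ)) := by
      rw [hc, Finset.prod_range_succ', mul_comm]
      simp [sub_sub, add_comm]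
    have hd : ∀ y : ℝ, 0 < y → HasDerivAt
        (fun z => c * (fwdDiff (1 : ℝ))^[k] (fun y : ℝ => y ^ q) z)
        (c * (q * (fwdDiff (1 : ℝ))^[k] (fun y : ℝ => y ^ (q - 1)) y)) y := fun y hy =>
      (hasDerivAt_fwdDiff_iter_rpow q k hy).const_mul c
    have hmono : MonotoneOn (fun z => c * (fwdDiff (1 : ℝ))^[k] (fun y : ℝ => y ^ q) z)
        (Set.Ioi 0) := by
      refine monotoneOn_of_deriv_nonneg (convex_Ioi 0)
        (fun y hy => (hd y hy).continuousAt.continuousWithinAt) ?_ ?_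
      · rw [interior_Ioi]
        exact fun y hy => (hd y hy).differentiableAt.differentiableWithinAt
      · rw [interior_Ioi]
        intro y hy
        rw [(hd y hy).deriv, hc']
        have := mul_nonneg (sq_nonneg q) (ih (q - 1) (x := y) hy)
        linarith
    have := hmono hx (show (0 : ℝ) < x + 1 by linarith) (by linarith)
    rw [Function.iterate_succ_apply', fwdDiff, mul_sub]
    linarith

lemma continuous_fwdDiff_iter {f : ℝ → ℝ} (hf : Continuous f) (k : ℕ) :
    Continuous ((fwdDiff (1 : ℝ))^[k] f) := by
  induction k with
  | zero => simpa
  | succ k ih =>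
    rw [Function.iterate_succ_apply']
    exact (ih.comp (continuous_add_const 1)).sub ih

lemma fwdDiff_iter_rpow_sign {q : ℝ} (hq : 0 < q) (k : ℕ) {x : ℝ} (hx : 0 ≤ x) :
    0 ≤ (∏ i ∈ Finset.range k, (q - i)) * (fwdDiff (1 : ℝ))^[k] (fun y : ℝ => y ^ q) x := by
  have hcl : IsClosed {x : ℝ | 0 ≤ (∏ i ∈ Finset.range k, (q - i)) *
      (fwdDiff (1 : ℝ))^[k] (fun y : ℝ => y ^ q) x} :=
    isClosed_le continuous_const (continuous_const.mul
      (continuous_fwdDiff_iter (Real.continuous_rpow_const hq.le) k))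
  have hsub := hcl.closure_subset_iff.2 (fun y (hy : y ∈ Set.Ioi (0 : ℝ)) =>
    fwdDiff_iter_rpow_sign_of_pos q k hy)
  rw [closure_Ioi] at hsub
  exact hsub hx

/-- For `0 < q < 2` the second, third and fourth forward differences of `x ^ q` have alternating
constant signs on `[0, ∞)`. -/
lemma exists_sign_fwdDiff_rpow {q : ℝ} (hq : 0 < q) (hq2 : q < 2) :
    ∃ ε : ℝ, |ε| = 1 ∧ 0 ≤ ε * (q - 1) ∧ ∀ x : ℝ, 0 ≤ x →
      0 ≤ ε * (fwdDiff (1 : ℝ))^[2] (fun y : ℝ => y ^ q) x ∧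
      ε * (fwdDiff (1 : ℝ))^[3] (fun y : ℝ => y ^ q) x ≤ 0 ∧
      0 ≤ ε * (fwdDiff (1 : ℝ))^[4] (fun y : ℝ => y ^ q) x := by
  have h2 := fun {x : ℝ} (hx : 0 ≤ x) => fwdDiff_iter_rpow_sign hq 2 hx
  have h3 := fun {x : ℝ} (hx : 0 ≤ x) => fwdDiff_iter_rpow_sign hq 3 hx
  have h4 := fun {x : ℝ} (hx : 0 ≤ x) => fwdDiff_iter_rpow_sign hq 4 hx
  simp only [Finset.prod_range_succ, Finset.prod_range_zero, one_mul, Nat.cast_zero, sub_zero,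
    Nat.cast_one, Nat.cast_ofNat] at h2 h3 h4
  rcases lt_trichotomy q 1 with h | h | h
  · refine ⟨-1, by simp, by linarith, fun x hx => ⟨?_, ?_, ?_⟩⟩
    · have := nonpos_of_mul_nonneg_right (h2 hx) (mul_neg_of_pos_of_neg hq (by linarith))
      linarith
    · have := nonneg_of_mul_nonneg_right (h3 hx)
        (mul_pos_of_neg_of_neg (mul_neg_of_pos_of_neg hq (by linarith)) (by linarith))
      linarith
    · have := nonpos_of_mul_nonneg_right (h4 hx) (mul_neg_of_pos_of_neg
        (mul_pos_of_neg_of_neg (mul_neg_of_pos_of_neg hq (by linarith)) (by linarith))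
        (by linarith))
      linarith
  -- At `q = 1` the products vanish and carry no sign information, but `y ^ q` is linear and the
  -- differences are zero.
  · subst h
    have h0 : (fwdDiff (1 : ℝ))^[2] (fun y : ℝ => y ^ (1 : ℝ)) = fun _ => 0 := by
      ext x
      simp only [Function.iterate_succ, Function.iterate_zero, Function.comp, id, fwdDiff,
        Real.rpow_one]
      ring
    refine ⟨1, by simp, by simp, fun x _ => ?_⟩
    rw [Function.iterate_succ_apply' _ 3, Function.iterate_succ_apply' _ 2, h0]
    simp [fwdDiff]
  · refine ⟨1, by simp, by linarith, fun x hx => ⟨?_, ?_, ?_⟩⟩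
    · have := nonneg_of_mul_nonneg_right (h2 hx) (mul_pos hq (by linarith))
      linarith
    · have := nonpos_of_mul_nonneg_right (h3 hx)
        (mul_neg_of_pos_of_neg (mul_pos hq (by linarith)) (by linarith))
      linarith
    · have := nonneg_of_mul_nonneg_right (h4 hx) (mul_pos_of_neg_of_neg
        (mul_neg_of_pos_of_neg (mul_pos hq (by linarith)) (by linarith)) (by linarith))
      linarith

/-! ### Covariances of the increments and their absolute sums. -/

/-- The covariance at lag `r` of the second-order increments of step one of a fractional Brownian
motion with Hurst index `q / 2`. -/
noncomputable def secondOrderCov (q r : ℝ) : ℝ :=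
  1 / 2 * (-|r - 2| ^ q + 4 * |r - 1| ^ q - 6 * |r| ^ q + 4 * |r + 1| ^ q - |r + 2| ^ q)

lemma secondOrderCov_neg (q r : ℝ) : secondOrderCov q (-r) = secondOrderCov q r := by
  have h1 : |-r - 2| = |r + 2| := by rw [← abs_neg]; ring_nf
  have h2 : |-r - 1| = |r + 1| := by rw [← abs_neg]; ring_nf
  have h3 : |-r + 1| = |r - 1| := by rw [← abs_neg]; ring_nf
  have h4 : |-r + 2| = |r - 2| := by rw [← abs_neg]; ring_nf
  rw [secondOrderCov, secondOrderCov, h1, h2, h3, h4, abs_neg]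
  ring

lemma secondOrderCov_zero {q : ℝ} (hq : 0 < q) : secondOrderCov q 0 = 4 - 2 ^ q := by
  simp only [secondOrderCov, zero_sub, zero_add, abs_neg, abs_one, Real.one_rpow, abs_zero,
    Real.zero_rpow hq.ne', abs_two]
  ring

lemma secondOrderCov_add_two (q : ℝ) {x : ℝ} (hx : 0 ≤ x) :
    secondOrderCov q (x + 2) = -(1 / 2) * (fwdDiff (1 : ℝ))^[4] (fun y : ℝ => y ^ q) x := by
  have e0 : |x + 2 - 2| = x := by rw [add_sub_cancel_right, abs_of_nonneg hx]
  have e1 : |x + 2 - 1| = x + 1 := by rw [abs_of_nonneg (by linarith)]; ring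
  have e2 : |x + 2| = x + 1 + 1 := by rw [abs_of_nonneg (by linarith)]; ring
  have e3 : |x + 2 + 1| = x + 1 + 1 + 1 := by rw [abs_of_nonneg (by linarith)]; ring
  have e4 : |x + 2 + 2| = x + 1 + 1 + 1 + 1 := by rw [abs_of_nonneg (by linarith)]; ring
  simp only [secondOrderCov, e0, e1, e2, e3, e4, Function.iterate_succ, Function.iterate_zero,
    Function.comp, id, fwdDiff]
  ring

/-- Constant sign of the fourth difference makes the sum of absolute values telescope in the third
difference. The boundary term at `N` has the opposite sign to the fourth difference and can be
dropped. -/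
lemma sum_abs_secondOrderCov_add_two_le {q : ℝ} (hq : 0 < q) (hq2 : q < 2) (N : ℕ) :
    ∑ r ∈ Finset.range N, |secondOrderCov q (r + 2)| ≤
      1 / 2 * |(fwdDiff (1 : ℝ))^[3] (fun y : ℝ => y ^ q) 0| := by
  obtain ⟨ε, hε, -, h⟩ := exists_sign_fwdDiff_rpow hq hq2
  set D := (fwdDiff (1 : ℝ))^[3] (fun y : ℝ => y ^ q) with hD
  have key : ∀ r : ℕ, |secondOrderCov q (r + 2)| = 1 / 2 * (ε * D (r + 1 : ℕ) - ε * D r) := by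
    intro r
    have h4 := (h r r.cast_nonneg).2.2
    have habs : |(fwdDiff (1 : ℝ))^[4] (fun y : ℝ => y ^ q) r| =
        ε * (fwdDiff (1 : ℝ))^[4] (fun y : ℝ => y ^ q) r := by
      rw [← abs_of_nonneg h4, abs_mul, hε, one_mul]
    rw [secondOrderCov_add_two q r.cast_nonneg, abs_mul, habs,
      Function.iterate_succ_apply' _ 3, ← hD, fwdDiff]
    norm_num
    ring
  rw [Finset.sum_congr rfl fun r _ => key r, ← Finset.mul_sum,
    Finset.sum_range_sub (fun r : ℕ => ε * D r), Nat.cast_zero]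
  have h3 := (h N N.cast_nonneg).2.1
  have h0 : -(ε * D 0) ≤ |D 0| := by
    rw [← one_mul |D 0|, ← hε, ← abs_mul]
    exact neg_le_abs _
  linarith

/-- The 7 is 3 for lag 0, 3 for lag 1 and half of 2 for the remaining lags. -/
lemma sum_abs_secondOrderCov_le {q : ℝ} (hq : 0 < q) (hq2 : q < 2) (N : ℕ) :
    ∑ r ∈ Finset.range N, |secondOrderCov q r| ≤ 7 := by
  have hu1 : (1 : ℝ) ≤ 2 ^ q := Real.one_le_rpow (by norm_num) hq.le
  have hu4 : (2 : ℝ) ^ q ≤ 4 := by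
    calc (2 : ℝ) ^ q ≤ 2 ^ (2 : ℝ) := Real.rpow_le_rpow_of_exponent_le (by norm_num) hq2.le
      _ = 4 := by norm_num
  have huv : (2 : ℝ) ^ q ≤ 3 ^ q := Real.rpow_le_rpow (by norm_num) (by norm_num) hq.le
  obtain ⟨ε, hε, hεq, h⟩ := exists_sign_fwdDiff_rpow hq hq2
  have hc2 := (h 1 zero_le_one).1
  have hc3 := (h 0 le_rfl).2.1
  have hD0 : (fwdDiff (1 : ℝ))^[3] (fun y : ℝ => y ^ q) 0 = 3 ^ q - 3 * 2 ^ q + 3 := by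
    simp only [Function.iterate_succ, Function.iterate_zero, Function.comp, id, fwdDiff]
    norm_num [Real.zero_rpow hq.ne']
    ring
  have hD2 : (fwdDiff (1 : ℝ))^[2] (fun y : ℝ => y ^ q) 1 = 3 ^ q - 2 * 2 ^ q + 1 := by
    simp only [Function.iterate_succ, Function.iterate_zero, Function.comp, id, fwdDiff]
    norm_num
    ring
  have hr1 : secondOrderCov q 1 = (4 * 2 ^ q - 3 ^ q - 7) / 2 := by
    norm_num [secondOrderCov, Real.zero_rpow hq.ne']
    ring
  have htail := sum_abs_secondOrderCov_add_two_le hq hq2 N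
  rw [hD0] at hc3 htail
  rw [hD2] at hc2
  -- The signs of the second difference at 1 and of the third at 0 confine `3 ^ q` between affine
  -- functions of `2 ^ q`; the sign of `q - 1` places `2 ^ q` relative to 2.
  have hbounds : |(3 : ℝ) ^ q - 3 * 2 ^ q + 3| ≤ 2 ∧ |secondOrderCov q 1| ≤ 3 := by
    rw [hr1, abs_le, abs_le]
    rcases (abs_eq zero_le_one).1 hε with rfl | rfl
    · have : (2 : ℝ) ≤ 2 ^ q := by
        simpa using Real.rpow_le_rpow_of_exponent_le (x := 2) (by norm_num)
          (show (1 : ℝ) ≤ q by linarith)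
      refine ⟨⟨?_, ?_⟩, ?_, ?_⟩ <;> linarith
    · have : (2 : ℝ) ^ q ≤ 2 := by
        simpa using Real.rpow_le_rpow_of_exponent_le (x := 2) (by norm_num)
          (show q ≤ 1 by linarith)
      refine ⟨⟨?_, ?_⟩, ?_, ?_⟩ <;> linarith
  have h0 : |secondOrderCov q 0| ≤ 3 := by
    rw [secondOrderCov_zero hq, abs_le]
    constructor <;> linarith
  calc ∑ r ∈ Finset.range N, |secondOrderCov q r|
      ≤ ∑ r ∈ Finset.range (N + 2), |secondOrderCov q r| :=
        Finset.sum_le_sum_of_subset_of_nonneg (Finset.range_mono (by omega))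
          fun _ _ _ => abs_nonneg _
    _ = ∑ r ∈ Finset.range N, |secondOrderCov q (r + 2)| + |secondOrderCov q 1|
          + |secondOrderCov q 0| := by
        rw [Finset.sum_range_succ', Finset.sum_range_succ']
        simp [add_assoc, one_add_one_eq_two]
    _ ≤ 7 := by linarith [hbounds.1, hbounds.2]

lemma sum_abs_secondOrderCov_sub_le {q : ℝ} (hq : 0 < q) (hq2 : q < 2) {n : ℕ} (j : Fin n) :
    ∑ k : Fin n, |secondOrderCov q ((k : ℕ) - (j : ℕ) : ℝ)| ≤ 14 := by
  have hj := j.2.le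
  rw [Fin.sum_univ_eq_sum_range (fun k : ℕ => |secondOrderCov q ((k : ℝ) - (j : ℕ))|) n,
    ← Finset.sum_range_add_sum_Ico _ hj]
  -- Left of the diagonal the lags, by symmetry, are `1, …, j`; lag 0 is added to fit the one-sided
  -- bound.
  have h1 : ∑ k ∈ Finset.range j, |secondOrderCov q ((k : ℝ) - (j : ℕ))| ≤ 7 := by
    refine le_trans ?_ (sum_abs_secondOrderCov_le hq hq2 (j + 1))
    rw [Finset.sum_range_succ']
    refine le_add_of_le_of_nonneg (le_of_eq ?_) (abs_nonneg _)
    rw [← Finset.sum_range_reflect]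
    refine Finset.sum_congr rfl fun k hk => ?_
    have hk := Finset.mem_range.1 hk
    rw [← secondOrderCov_neg]
    congr 2
    rw [Nat.sub_sub, Nat.cast_sub (by omega)]
    push_cast
    ring
  have h2 : ∑ k ∈ Finset.Ico (j : ℕ) n, |secondOrderCov q ((k : ℝ) - (j : ℕ))| ≤ 7 := by
    rw [Finset.sum_Ico_eq_sum_range]
    refine le_trans (le_of_eq ?_) (sum_abs_secondOrderCov_le hq hq2 (n - j))
    refine Finset.sum_congr rfl fun k _ => ?_
    push_cast
    ring_nf
  linarith

/-! ### Exponential moments and concentration for sums of Gaussian squares. -/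

/-- From order two on, the logarithmic series is dominated by `y ^ 2 / 2` times a geometric series
in `|y|`. -/
lemma neg_log_one_sub_le {y : ℝ} (hy : |y| < 1) :
    -Real.log (1 - y) ≤ y + y ^ 2 / (2 * (1 - |y|)) := by
  have h1 := (hasSum_nat_add_iff' 1).2 (Real.hasSum_pow_div_log_of_abs_lt_one hy)
  have h2 := (hasSum_geometric_of_abs_lt_one (r := |y|) (by rwa [abs_abs])).mul_left (y ^ 2 / 2)
  have h := hasSum_le (fun i => ?_) h1 h2
  · simp only [Finset.range_one, Finset.sum_singleton, Nat.cast_zero, zero_add, pow_one,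
      div_one] at h
    have e : y ^ 2 / (2 * (1 - |y|)) = y ^ 2 / 2 * (1 - |y|)⁻¹ := by
      rw [← div_div, div_eq_mul_inv (y ^ 2 / 2)]
    linarith
  · calc y ^ (i + 1 + 1) / ((i + 1 : ℕ) + 1 : ℝ) ≤ |y ^ (i + 1 + 1)| / ((i + 1 : ℕ) + 1 : ℝ) := by
          gcongr; exact le_abs_self _
      _ ≤ |y ^ (i + 1 + 1)| / 2 := by
          gcongr
          push_cast
          linarith [(Nat.cast_nonneg i : (0 : ℝ) ≤ i)]
      _ = y ^ 2 / 2 * |y| ^ i := by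
          rw [abs_pow, ← sq_abs y]; ring

lemma mgf_sq_gaussianReal {v : ℝ≥0} {s : ℝ} (hs : 2 * s * v < 1) :
    mgf (fun x => x ^ 2) (gaussianReal 0 v) s = (√(1 - 2 * s * v))⁻¹ := by
  rcases eq_or_ne v 0 with rfl | hv
  · simp [mgf]
  have hv' : (0 : ℝ) < v := by positivity
  have hpos : 0 < 1 - 2 * s * v := by linarith
  rw [mgf, integral_gaussianReal_eq_integral_smul hv]
  have e : ∀ x : ℝ, gaussianPDFReal 0 v x • Real.exp (s * x ^ 2) =
      (√(2 * Real.pi * v))⁻¹ * Real.exp (-((1 - 2 * s * v) / (2 * v)) * x ^ 2) := by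
    intro x
    rw [gaussianPDFReal, smul_eq_mul, mul_assoc, ← Real.exp_add]
    congr 2
    field_simp
    ring
  simp_rw [e]
  rw [integral_const_mul, integral_gaussian, ← Real.sqrt_inv, ← Real.sqrt_inv,
    ← Real.sqrt_mul (by positivity)]
  congr 1
  field_simp

section

variable {Ω : Type*} [MeasurableSpace Ω] {P : Measure Ω}

lemma mgf_sq_of_map_eq_gaussianReal {Y : Ω → ℝ} (hm : AEMeasurable Y P) {v : ℝ≥0}
    (hY : P.map Y = gaussianReal 0 v) {s : ℝ} (hs : 2 * s * v < 1) :
    mgf (fun ω => Y ω ^ 2) P s = (√(1 - 2 * s * v))⁻¹ := by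
  rw [← mgf_sq_gaussianReal hs, ← hY, mgf_map hm (by fun_prop)]
  rfl

/-- The log-moment generating function is `-log (1 - 2 s v) / 2`, to which the series bound applies.
Using `|s|` covers both signs, hence both tails. -/
lemma mgf_sq_le {Y : Ω → ℝ} (hm : AEMeasurable Y P) {v : ℝ≥0}
    (hY : P.map Y = gaussianReal 0 v) {s : ℝ} (hs : 2 * |s| * v < 1) :
    mgf (fun ω => Y ω ^ 2) P s ≤ Real.exp (s * v + s ^ 2 * v ^ 2 / (1 - 2 * |s| * v)) := by
  have habs : |2 * s * v| = 2 * |s| * v := by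
    rw [abs_mul, abs_mul, abs_two, abs_of_nonneg v.coe_nonneg]
  have hlt : 2 * s * v < 1 := (le_abs_self _).trans_lt (habs ▸ hs)
  have hpos : 0 < 1 - 2 * s * v := by linarith
  rw [mgf_sq_of_map_eq_gaussianReal hm hY hlt, ← Real.exp_log (show 0 < (√(1 - 2 * s * v))⁻¹ by
    positivity), Real.exp_le_exp, Real.log_inv, Real.log_sqrt hpos.le]
  have h := neg_log_one_sub_le (habs ▸ hs : |2 * s * v| < 1)
  rw [habs] at h
  have e : (2 * s * v) ^ 2 / (2 * (1 - 2 * |s| * v)) =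
      2 * (s ^ 2 * v ^ 2 / (1 - 2 * |s| * v)) := by
    have : 1 - 2 * |s| * v ≠ 0 := by linarith
    field_simp
  rw [e] at h
  linarith

section Chernoff

variable {ι : Type*} [Fintype ι] {Y : ι → Ω → ℝ} {v : ι → ℝ≥0}

lemma mgf_sum_sq (hind : iIndepFun Y P) (hm : ∀ i, AEMeasurable (Y i) P) (s : ℝ) :
    mgf (fun ω => ∑ i, Y i ω ^ 2) P s = ∏ i, mgf (fun ω => Y i ω ^ 2) P s := by
  have hind2 : iIndepFun (fun i ω => Y i ω ^ 2) P :=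
    hind.comp (fun _ x => x ^ 2) fun _ => by fun_prop
  have e : (fun ω => ∑ i, Y i ω ^ 2) = ∑ i, fun ω => Y i ω ^ 2 := by ext; simp
  rw [e, hind2.mgf_sum₀ (fun i => (hm i).pow_const 2)]

/-- The estimate `v i ^ 2 ≤ L * v i` reduces the quadratic term to the largest variance times the
total variance. -/
lemma mgf_sum_sq_le (hind : iIndepFun Y P) (hm : ∀ i, AEMeasurable (Y i) P)
    (hY : ∀ i, P.map (Y i) = gaussianReal 0 (v i)) {L M s : ℝ} (hL : 0 ≤ L)
    (hv : ∀ i, v i ≤ L) (hM : ∑ i, (v i : ℝ) ≤ M) (hs : 2 * |s| * L < 1) :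
    mgf (fun ω => ∑ i, Y i ω ^ 2) P s ≤
      Real.exp (s * ∑ i, (v i : ℝ) + s ^ 2 * (L * M) / (1 - 2 * |s| * L)) := by
  have hsv : ∀ i, 2 * |s| * v i ≤ 2 * |s| * L := fun i => by gcongr; exact hv i
  have hden : 0 < 1 - 2 * |s| * L := by linarith
  rw [mgf_sum_sq hind hm]
  calc ∏ i, mgf (fun ω => Y i ω ^ 2) P s
      ≤ ∏ i, Real.exp (s * v i + s ^ 2 * (L * v i) / (1 - 2 * |s| * L)) := by
        refine Finset.prod_le_prod (fun i _ => mgf_nonneg) fun i _ => ?_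
        refine (mgf_sq_le (hm i) (hY i) ((hsv i).trans_lt hs)).trans (Real.exp_le_exp.2 ?_)
        have h1 : (v i : ℝ) ^ 2 ≤ L * v i := by
          rw [sq]; exact mul_le_mul_of_nonneg_right (hv i) (v i).coe_nonneg
        have h0 : 0 ≤ L * v i := (sq_nonneg _).trans h1
        have h2 := hsv i
        gcongr
    _ = Real.exp (s * ∑ i, (v i : ℝ)
          + s ^ 2 * (L * ∑ i, (v i : ℝ)) / (1 - 2 * |s| * L)) := by
        rw [← Real.exp_sum, Finset.sum_add_distrib, ← Finset.mul_sum, ← Finset.sum_div,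
          ← Finset.mul_sum, ← Finset.mul_sum]
    _ ≤ _ := by
        gcongr

/-- Bernstein-type concentration of a sum of squares of independent centered Gaussian variables
around its mean. -/
theorem measureReal_abs_sum_sq_sub_ge_le (hind : iIndepFun Y P) (hm : ∀ i, AEMeasurable (Y i) P)
    (hY : ∀ i, P.map (Y i) = gaussianReal 0 (v i)) {L M x : ℝ} (hL : 0 < L) (hM0 : 0 < M)
    (hv : ∀ i, v i ≤ L) (hM : ∑ i, (v i : ℝ) ≤ M) (hx : 0 < x) :
    P.real {ω | x ≤ |∑ i, Y i ω ^ 2 - ∑ i, (v i : ℝ)|} ≤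
      2 * Real.exp (-(x ^ 2 / (4 * L * (x + M)))) := by
  have := hind.isProbabilityMeasure
  set m := ∑ i, (v i : ℝ)
  -- With this choice `1 - 2 t L = M / (x + M)`, and the Chernoff exponent collapses to `-t x + t² L
  -- (x + M)`, which is minimal at this `t`.
  set t := x / (2 * L * (x + M)) with ht
  have ht0 : 0 < t := by positivity
  have h2tL : 2 * t * L = x / (x + M) := by rw [ht]; field_simp
  have h1 : 1 - 2 * t * L = M / (x + M) := by rw [h2tL]; field_simp; ring
  have hlt : 2 * t * L < 1 := by rw [h2tL, div_lt_one (by positivity)]; linarith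
  have hint : ∀ s, |s| = t → Integrable (fun ω => Real.exp (s * ∑ i, Y i ω ^ 2)) P := by
    intro s hs
    -- The integral of a non-integrable function is 0 by convention, so a nonzero closed form proves
    -- integrability.
    refine .of_integral_ne_zero ?_
    change mgf (fun ω => ∑ i, Y i ω ^ 2) P s ≠ 0
    rw [mgf_sum_sq hind hm]
    refine Finset.prod_ne_zero_iff.2 fun i _ => ?_
    have h : 2 * s * v i < 1 := by
      refine lt_of_le_of_lt ?_ hlt
      rw [← hs]
      gcongr
      exacts [le_abs_self s, hv i]
    rw [mgf_sq_of_map_eq_gaussianReal (hm i) (hY i) h]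
    have : 0 < 1 - 2 * s * v i := by linarith
    positivity
  have hexp : -t * x + t ^ 2 * (L * M) / (1 - 2 * t * L) = -(x ^ 2 / (4 * L * (x + M))) := by
    rw [h1, ht]; field_simp; ring
  have hup : P.real {ω | m + x ≤ ∑ i, Y i ω ^ 2} ≤ Real.exp (-(x ^ 2 / (4 * L * (x + M)))) := by
    refine (measure_ge_le_exp_mul_mgf (m + x) ht0.le (hint t (abs_of_pos ht0))).trans ?_
    have h := mgf_sum_sq_le hind hm hY (s := t) hL.le hv hM (by rwa [abs_of_pos ht0])
    rw [abs_of_pos ht0] at h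
    refine (mul_le_mul_of_nonneg_left h (Real.exp_pos _).le).trans (le_of_eq ?_)
    rw [← Real.exp_add, ← hexp]
    congr 1
    ring
  have hlow : P.real {ω | ∑ i, Y i ω ^ 2 ≤ m - x} ≤ Real.exp (-(x ^ 2 / (4 * L * (x + M)))) := by
    have habs : |-t| = t := by rw [abs_neg, abs_of_pos ht0]
    refine (measure_le_le_exp_mul_mgf (m - x) (neg_nonpos.2 ht0.le) (hint (-t) habs)).trans ?_
    have h := mgf_sum_sq_le hind hm hY (s := -t) hL.le hv hM (by rwa [habs])
    rw [habs] at h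
    refine (mul_le_mul_of_nonneg_left h (Real.exp_pos _).le).trans (le_of_eq ?_)
    rw [← Real.exp_add, ← hexp]
    congr 1
    ring
  calc P.real {ω | x ≤ |∑ i, Y i ω ^ 2 - m|}
      ≤ P.real ({ω | m + x ≤ ∑ i, Y i ω ^ 2} ∪ {ω | ∑ i, Y i ω ^ 2 ≤ m - x}) := by
        refine measureReal_mono fun ω hω => ?_
        rcases le_abs.1 (show x ≤ |∑ i, Y i ω ^ 2 - m| from hω) with h | h
        · exact Or.inl (show m + x ≤ _ by linarith)
        · exact Or.inr (show _ ≤ m - x by linarith)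
    _ ≤ _ := measureReal_union_le _ _
    _ ≤ _ := by linarith

end Chernoff

/-! ### Diagonalization of Gaussian vectors. -/

/-- Gershgorin bound for the eigenvalues of a real symmetric matrix. -/
lemma Matrix.IsHermitian.eigenvalues_le_of_sum_abs_le {ι : Type*} [Fintype ι] [DecidableEq ι]
    {A : Matrix ι ι ℝ} (hA : A.IsHermitian) {L : ℝ} (hL : ∀ j, ∑ k, |A j k| ≤ L) (i : ι) :
    hA.eigenvalues i ≤ L := by
  have hev : Module.End.HasEigenvalue (Matrix.toLin' A) (hA.eigenvalues i) := by
    rw [Module.End.hasEigenvalue_iff_mem_spectrum, Matrix.spectrum_toLin']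
    exact hA.eigenvalues_mem_spectrum_real i
  obtain ⟨k, hk⟩ := eigenvalue_mem_ball hev
  have h := (abs_le.1 (Metric.mem_closedBall.1 hk)).2
  have hsum := Finset.add_sum_erase Finset.univ (fun j => |A k j|) (Finset.mem_univ k)
  have := hL k
  have := le_abs_self (A k k)
  simp only [Real.norm_eq_abs] at h
  linarith

/-- A centered Gaussian vector is, after an orthogonal change of coordinates, a vector of
independent centered Gaussian variables whose variances are the eigenvalues of the covariance
matrix. -/
theorem exists_iIndepFun_sum_sq_eq {ι : Type*} [Fintype ι] [DecidableEq ι] {X : ι → Ω → ℝ}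
    (hX : HasGaussianLaw (fun ω i => X i ω) P) (hX0 : ∀ i, ∫ ω, X i ω ∂P = 0)
    {A : Matrix ι ι ℝ} (hA : A.IsHermitian) (hcov : ∀ i j, cov[X i, X j; P] = A i j) :
    ∃ (Y : ι → Ω → ℝ) (v : ι → ℝ≥0), iIndepFun Y P ∧ (∀ i, AEMeasurable (Y i) P) ∧
      (∀ i, P.map (Y i) = gaussianReal 0 (v i)) ∧ (∀ i, (v i : ℝ) = hA.eigenvalues i) ∧
      ∀ ω, ∑ i, X i ω ^ 2 = ∑ i, Y i ω ^ 2 := by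
  have := hX.isProbabilityMeasure
  set b := hA.eigenvectorBasis
  set Y : ι → Ω → ℝ := fun i ω => ∑ k, b i k * X k ω with hYdef
  have hXL : ∀ k, MemLp (X k) 2 P := fun k => (hX.eval k).memLp_two
  have hYG : HasGaussianLaw (fun ω i => Y i ω) P := by
    have h := hX.map_fun (ContinuousLinearMap.pi fun i =>
      ∑ k, (b i k) • ContinuousLinearMap.proj (R := ℝ) (φ := fun _ : ι => ℝ) k)
    refine h.congr (.of_forall fun ω => ?_)
    ext i
    simp [hYdef]
  have hYcov : ∀ i j, cov[Y i, Y j; P] = if i = j then hA.eigenvalues i else 0 := by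
    intro i j
    have h1 : cov[Y i, Y j; P] = b i ⬝ᵥ (A.mulVec (b j)) := by
      rw [hYdef, covariance_fun_sum_fun_sum (fun k => (hXL k).const_mul _)
        (fun k => (hXL k).const_mul _)]
      simp only [covariance_const_mul_left, covariance_const_mul_right, hcov, dotProduct,
        Matrix.mulVec, Finset.mul_sum]
      exact Finset.sum_congr rfl fun k _ => Finset.sum_congr rfl fun l _ => by ring
    have h2 : (b i : ι → ℝ) ⬝ᵥ (b j : ι → ℝ) = inner ℝ (b j) (b i) := by
      rw [EuclideanSpace.inner_eq_star_dotProduct]; simp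
    rw [h1, hA.mulVec_eigenvectorBasis, dotProduct_smul, h2,
      orthonormal_iff_ite.1 b.orthonormal j i]
    by_cases h : i = j
    · subst h; simp
    · simp [h, Ne.symm h]
  have hY0 : ∀ i, ∫ ω, Y i ω ∂P = 0 := by
    intro i
    rw [integral_finsetSum _ fun k _ => ((hXL k).integrable (by norm_num)).const_mul _]
    simp [integral_const_mul, hX0]
  have hvar : ∀ i, Var[Y i; P] = hA.eigenvalues i := fun i => by
    rw [← covariance_self (hYG.eval i).aemeasurable, hYcov, if_pos rfl]
  refine ⟨Y, fun i => Var[Y i; P].toNNReal,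
    hYG.iIndepFun_of_covariance_eq_zero fun i j hij => by rw [hYcov, if_neg hij],
    fun i => (hYG.eval i).aemeasurable, fun i => ?_, fun i => ?_, fun ω => ?_⟩
  · rw [(hYG.eval i).map_eq_gaussianReal, hY0]
  · rw [Real.coe_toNNReal _ (variance_nonneg _ _), hvar]
  -- Parseval in the eigenbasis: the change of coordinates preserves the sum of squares.
  · have h := b.sum_sq_norm_inner_right (WithLp.toLp 2 fun k => X k ω)
    rw [EuclideanSpace.norm_sq_eq] at h
    simp only [Real.norm_eq_abs, sq_abs] at h
    rw [← h]
    refine Finset.sum_congr rfl fun i _ => ?_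
    rw [hYdef, EuclideanSpace.inner_eq_star_dotProduct]
    simp [dotProduct, mul_comm]

/-- Concentration of the squared norm of a centered Gaussian vector whose covariance matrix has
absolute row sums at most `L` and trace at most `M`. -/
theorem ProbabilityTheory.HasGaussianLaw.measureReal_abs_sum_sq_sub_trace_ge_le {ι : Type*} [Fintype ι]
    [DecidableEq ι] {X : ι → Ω → ℝ}
    (hX : HasGaussianLaw (fun ω i => X i ω) P) (hX0 : ∀ i, ∫ ω, X i ω ∂P = 0)
    {A : Matrix ι ι ℝ} (hcov : ∀ i j, cov[X i, X j; P] = A i j) {L M x : ℝ} (hL0 : 0 < L)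
    (hL : ∀ j, ∑ k, |A j k| ≤ L) (hM0 : 0 < M) (hM : A.trace ≤ M) (hx : 0 < x) :
    P.real {ω | x ≤ |∑ i, X i ω ^ 2 - A.trace|} ≤
      2 * Real.exp (-(x ^ 2 / (4 * L * (x + M)))) := by
  have hA : A.IsHermitian := by
    ext i j
    simp [← hcov, covariance_comm]
  obtain ⟨Y, v, hind, hm, hY, hv, hsum⟩ := exists_iIndepFun_sum_sq_eq hX hX0 hA hcov
  have htr : A.trace = ∑ i, (v i : ℝ) := by
    simp [hA.trace_eq_sum_eigenvalues, hv]
  simp only [hsum, htr]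
  exact measureReal_abs_sum_sq_sub_ge_le hind hm hY hL0 hM0
    (fun i => hv i ▸ hA.eigenvalues_le_of_sum_abs_le hL i) (htr ▸ hM) hx

end

/-! ### Second-order increments of fractional Brownian motion. -/

namespace IsFractionalBrownianMotion

variable {Ω : Type*} [MeasurableSpace Ω] {P : Measure Ω} {B : ℝ≥0 → Ω → ℝ} {H : ℝ}

lemma cov_eq (hB : IsFractionalBrownianMotion H B P) (s t : ℝ≥0) :
    cov[B s, B t; P] =
      1 / 2 * ((s : ℝ) ^ (2 * H) + (t : ℝ) ^ (2 * H) - |(t : ℝ) - (s : ℝ)| ^ (2 * H)) := by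
  have := hB.isGaussianProcess.isProbabilityMeasure
  rw [covariance_eq_sub (hB.isGaussianProcess.hasGaussianLaw_eval s).memLp_two
    (hB.isGaussianProcess.hasGaussianLaw_eval t).memLp_two, hB.centered, hB.centered,
    mul_zero, sub_zero, ← hB.covariance]
  rfl

/-- The `k`-th second-order increment of the process at mesh `1 / n`. -/
noncomputable def secondIncrement (B : ℝ≥0 → Ω → ℝ) (n k : ℕ) (ω : Ω) : ℝ :=
  B (((k : ℝ≥0) + 2) / (n : ℝ≥0)) ω - 2 * B (((k : ℝ≥0) + 1) / (n : ℝ≥0)) ω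
    + B ((k : ℝ≥0) / (n : ℝ≥0)) ω

lemma hasGaussianLaw_secondIncrement (hB : IsFractionalBrownianMotion H B P) (n : ℕ) :
    HasGaussianLaw (fun ω (k : Fin n) => secondIncrement B n k ω) P := by
  have h : HasGaussianLaw (fun ω (i : Fin (n + 2)) => B (((i : ℕ) : ℝ≥0) / (n : ℝ≥0)) ω) P := by
    have h := (hB.isGaussianProcess.comp_right
      (fun i : Fin (n + 2) => ((i : ℕ) : ℝ≥0) / (n : ℝ≥0))).hasGaussianLaw Finset.univ
    exact h.map_fun (ContinuousLinearMap.pi fun i => ContinuousLinearMap.proj (R := ℝ)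
      (φ := fun _ : (Finset.univ : Finset (Fin (n + 2))) => ℝ) ⟨i, Finset.mem_univ i⟩)
  have h2 := h.map_fun (ContinuousLinearMap.pi fun k : Fin n =>
    ContinuousLinearMap.proj (R := ℝ) (φ := fun _ : Fin (n + 2) => ℝ) ⟨k + 2, by omega⟩
    - (2 : ℝ) • ContinuousLinearMap.proj (R := ℝ) (φ := fun _ : Fin (n + 2) => ℝ) ⟨k + 1, by omega⟩
    + ContinuousLinearMap.proj (R := ℝ) (φ := fun _ : Fin (n + 2) => ℝ) ⟨k, by omega⟩)
  refine h2.congr (.of_forall fun ω => ?_)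
  ext k
  simp [secondIncrement]

lemma integral_secondIncrement (hB : IsFractionalBrownianMotion H B P) (n k : ℕ) :
    ∫ ω, secondIncrement B n k ω ∂P = 0 := by
  have hI : ∀ t, Integrable (B t) P := fun t =>
    (hB.isGaussianProcess.hasGaussianLaw_eval t).integrable
  simp only [secondIncrement]
  rw [integral_add (by exact (hI _).sub ((hI _).const_mul 2)) (hI _),
    integral_sub (hI _) ((hI _).const_mul 2), integral_const_mul]
  simp [hB.centered]

/-- In the bilinear expansion, terms depending on a single time cancel because the weights 1, -2, 1
sum to zero; homogeneity of the rest extracts the power of `n`. -/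
lemma cov_secondIncrement (hB : IsFractionalBrownianMotion H B P) {n : ℕ} (hn : 0 < n)
    (j k : ℕ) :
    cov[secondIncrement B n j, secondIncrement B n k; P] =
      ((n : ℝ) ^ (2 * H))⁻¹ * secondOrderCov (2 * H) ((k : ℝ) - j) := by
  have := hB.isGaussianProcess.isProbabilityMeasure
  have hL : ∀ t, MemLp (B t) 2 P := fun t =>
    (hB.isGaussianProcess.hasGaussianLaw_eval t).memLp_two
  have hrep : ∀ k, secondIncrement B n k =
      B (((k : ℝ≥0) + 2) / (n : ℝ≥0)) - (2 : ℝ) • B (((k : ℝ≥0) + 1) / (n : ℝ≥0))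
        + B ((k : ℝ≥0) / (n : ℝ≥0)) := fun k => rfl
  have hn' : (0 : ℝ) < n := by exact_mod_cast hn
  have hdiv : ∀ s t : ℝ, |t / n - s / n| ^ (2 * H) =
      ((n : ℝ) ^ (2 * H))⁻¹ * |t - s| ^ (2 * H) := by
    intro s t
    rw [← sub_div, abs_div, abs_of_pos hn', Real.div_rpow (abs_nonneg _) hn'.le]
    field_simp
  rw [hrep, hrep]
  have m2 : ∀ t, MemLp ((2 : ℝ) • B t) 2 P := fun t => (hL t).const_smul 2
  have msub : ∀ s t, MemLp (B s - (2 : ℝ) • B t) 2 P := fun s t => (hL s).sub (m2 t)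
  rw [covariance_add_left (msub _ _) (hL _) ((msub _ _).add (hL _)),
    covariance_add_right (msub _ _) (msub _ _) (hL _),
    covariance_add_right (hL _) (msub _ _) (hL _),
    covariance_sub_left (hL _) (m2 _) (msub _ _), covariance_sub_left (hL _) (m2 _) (hL _),
    covariance_sub_right (hL _) (hL _) (m2 _), covariance_sub_right (m2 _) (hL _) (m2 _),
    covariance_sub_right (hL _) (hL _) (m2 _)]
  simp only [covariance_smul_left, covariance_smul_right, hB.cov_eq]
  push_cast
  simp only [hdiv, secondOrderCov]
  have e1 : (k : ℝ) + 2 - (j + 2) = k - j := by ring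
  have e2 : (k : ℝ) + 1 - (j + 2) = k - j - 1 := by ring
  have e3 : (k : ℝ) - (j + 2) = k - j - 2 := by ring
  have e4 : (k : ℝ) + 2 - (j + 1) = k - j + 1 := by ring
  have e5 : (k : ℝ) + 1 - (j + 1) = k - j := by ring
  have e6 : (k : ℝ) - (j + 1) = k - j - 1 := by ring
  have e7 : (k : ℝ) + 2 - j = k - j + 2 := by ring
  have e8 : (k : ℝ) + 1 - j = k - j + 1 := by ring
  rw [e1, e2, e3, e4, e5, e6, e7, e8]
  ring

/-- Concentration of the normalized second-order variation of a fractional Brownian motion. -/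
theorem measureReal_abs_secondOrderVariation_sub_ge_le (hB : IsFractionalBrownianMotion H B P)
    (hH : 0 < H) (hH1 : H < 1) {n : ℕ} (hn : 0 < n) {a : ℝ} (ha : 0 < a) :
    P.real {ω | a * √(n : ℝ) ≤
        |(n : ℝ) ^ (2 * H) * secondOrderVariation B n ω - n * (4 - (4 : ℝ) ^ H)|} ≤
      2 * Real.exp (-(a ^ 2 / (71 * (a / √(n : ℝ) + 3)))) := by
  have hn' : (0 : ℝ) < n := by exact_mod_cast hn
  set c : ℝ := (n : ℝ) ^ H with hc
  have hcc : c * c = (n : ℝ) ^ (2 * H) := by rw [hc, ← Real.rpow_add hn', two_mul]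
  have h4 : (2 : ℝ) ^ (2 * H) = 4 ^ H := by
    rw [Real.rpow_mul (by norm_num)]; norm_num
  set A : Matrix (Fin n) (Fin n) ℝ := fun j k => secondOrderCov (2 * H) ((k : ℕ) - (j : ℕ) : ℝ)
    with hA
  set X : Fin n → Ω → ℝ := fun k ω => c * secondIncrement B n k ω with hX
  have hG : HasGaussianLaw (fun ω k => X k ω) P :=
    (hB.hasGaussianLaw_secondIncrement n).fun_smul c
  have hX0 : ∀ k, ∫ ω, X k ω ∂P = 0 := fun k => by
    rw [hX, integral_const_mul, hB.integral_secondIncrement, mul_zero]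
  have hcov : ∀ j k, cov[X j, X k; P] = A j k := fun j k => by
    have hne : (n : ℝ) ^ (2 * H) ≠ 0 := (Real.rpow_pos_of_pos hn' _).ne'
    rw [hX, covariance_const_mul_left, covariance_const_mul_right, ← mul_assoc, hcc]
    erw [hB.cov_secondIncrement hn]
    rw [mul_inv_cancel_left₀ hne]
  have htr : A.trace = n * (4 - (4 : ℝ) ^ H) := by
    simp [Matrix.trace, Matrix.diag, hA, secondOrderCov_zero (show 0 < 2 * H by linarith), h4,
      mul_sub]
  have h41 : (1 : ℝ) ≤ 4 ^ H := Real.one_le_rpow (by norm_num) hH.le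
  have hsq : 0 < √(n : ℝ) := Real.sqrt_pos.2 hn'
  have hM : A.trace ≤ 3 * n := by rw [htr]; nlinarith
  -- The row sums are at most 14; `71 / 4` is the weaker value making `4 L` the constant 71 of the
  -- level.
  have hL : ∀ j, ∑ k, |A j k| ≤ 71 / 4 := fun j =>
    (sum_abs_secondOrderCov_sub_le (by linarith) (by linarith) j).trans (by norm_num)
  have h := hG.measureReal_abs_sum_sq_sub_trace_ge_le hX0 hcov (by norm_num) hL
    (by positivity) hM (show 0 < a * √(n : ℝ) by positivity)
  have hS : ∀ ω, ∑ i, X i ω ^ 2 = (n : ℝ) ^ (2 * H) * secondOrderVariation B n ω := fun ω => by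
    rw [secondOrderVariation, Finset.mul_sum, ← Fin.sum_univ_eq_sum_range]
    refine Finset.sum_congr rfl fun k _ => ?_
    rw [hX, ← hcc, mul_pow, sq c]
    rfl
  simp only [hS, htr] at h
  refine h.trans (le_of_eq ?_)
  congr 3
  set r := √(n : ℝ)
  rw [← Real.sq_sqrt hn'.le]
  change (a * r) ^ 2 / (4 * (71 / 4) * (a * r + 3 * r ^ 2)) = _
  field_simp

end IsFractionalBrownianMotion

/-! ### From concentration to the confidence interval. -/

/-- Settles `n = 1`, where `log n = 0` makes the interval meaningless: the exponent is at least `-1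
/ 2`, so `2 exp (…) ≥ 1`. -/
lemma confidenceLevel_one {a : ℝ} (ha : 0 < a) (ha3 : a < 3) : confidenceLevel 1 a = 0 := by
  rw [confidenceLevel, Nat.cast_one, Real.sqrt_one, div_one]
  refine max_eq_right ?_
  have h1 : a ^ 2 / (71 * (a + 3)) ≤ 1 / 2 := by
    rw [div_le_iff₀ (by positivity)]; nlinarith
  have h2 := Real.add_one_le_exp (-(a ^ 2 / (71 * (a + 3))))
  linarith

/-- If the normalized second-order variation `n ^ (2H) S` is within `a √n` of its mean, then
`hurstTransform n H` belongs to the confidence interval. -/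
lemma hurstTransform_mem_Icc {n : ℕ} (hn : 1 < n) {H Hstar a S : ℝ} (hHs : H ≤ Hstar)
    (hHs1 : Hstar < 1) (ha : 0 < a) (ha' : a < (4 - (4 : ℝ) ^ Hstar) * √(n : ℝ))
    (hS : |(n : ℝ) ^ (2 * H) * S - n * (4 - (4 : ℝ) ^ H)| < a * √(n : ℝ)) :
    hurstTransform n H ∈
      Set.Icc (confidenceLeft n Hstar a S) (confidenceRight n Hstar a S) := by
  have hn1 : (1 : ℝ) < n := by exact_mod_cast hn
  have hn0 : (0 : ℝ) < n := by linarith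
  have hlog : 0 < Real.log n := Real.log_pos hn1
  have hr : 0 < √(n : ℝ) := Real.sqrt_pos.2 hn0
  have hrr : √(n : ℝ) * √(n : ℝ) = n := Real.mul_self_sqrt hn0.le
  have hp : 0 < (n : ℝ) ^ (2 * H) := Real.rpow_pos_of_pos hn0 _
  have hHH : (4 : ℝ) ^ H ≤ 4 ^ Hstar := Real.rpow_le_rpow_of_exponent_le (by norm_num) hHs
  have hs1 : (4 : ℝ) ^ Hstar < 4 := by
    simpa using Real.rpow_lt_rpow_of_exponent_lt (x := 4) (by norm_num) hHs1
  set τ := 4 - (4 : ℝ) ^ Hstar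
  set σ := 4 - (4 : ℝ) ^ H
  have hτ : 0 < τ := by simp only [τ]; linarith
  have hτσ : τ ≤ σ := by simp only [τ, σ]; linarith
  have hσ0 : 0 < σ := hτ.trans_le hτσ
  set δ := a / (τ * √(n : ℝ)) with hδ
  have hδ0 : 0 < δ := by positivity
  have hδ1 : δ < 1 := (div_lt_one (by positivity)).2 ha'
  -- The unknown `σ` may be replaced by the known `τ ≤ σ`: a deviation of `a √n` is at most a
  -- fraction `δ` of the mean `n σ`.
  have hbound : a * √(n : ℝ) ≤ δ * (n * σ) := by
    have e : a * √(n : ℝ) = δ * (n * τ) := by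
      calc a * √(n : ℝ) = δ * (√(n : ℝ) * √(n : ℝ) * τ) := by rw [hδ]; field_simp
        _ = δ * (n * τ) := by rw [hrr]
    rw [e]
    gcongr
  obtain ⟨hl, hu⟩ := abs_lt.1 (hS.trans_le hbound)
  have hlow : (1 - δ) * (n * σ) < (n : ℝ) ^ (2 * H) * S := by linarith
  have hupp : (n : ℝ) ^ (2 * H) * S < (1 + δ) * (n * σ) := by linarith
  have hd0 : 0 < 1 - δ := by linarith
  -- Here `δ < 1` is what makes `S` positive, so that its logarithm is genuine.
  have hS0 : 0 < S := pos_of_mul_pos_right (lt_trans (by positivity) hlow) hp.le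
  have l1 := Real.log_le_log (by positivity) hlow.le
  have l2 := Real.log_le_log (by positivity) hupp.le
  rw [Real.log_mul hp.ne' hS0.ne', Real.log_rpow hn0, Real.log_mul (by positivity) (by positivity),
    Real.log_mul hn0.ne' hσ0.ne'] at l1 l2
  rw [Set.mem_Icc, hurstTransform, confidenceLeft, confidenceRight]
  change 1 / 2 - _ + Real.log (1 - δ) / _ ≤ H - Real.log σ / _ ∧
    H - Real.log σ / _ ≤ 1 / 2 - _ + Real.log (1 + δ) / _
  have e1 : 1 / 2 - Real.log S / (2 * Real.log n) + Real.log (1 - δ) / (2 * Real.log n) =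
      (Real.log n - Real.log S + Real.log (1 - δ)) / (2 * Real.log n) := by field_simp
  have e2 : 1 / 2 - Real.log S / (2 * Real.log n) + Real.log (1 + δ) / (2 * Real.log n) =
      (Real.log n - Real.log S + Real.log (1 + δ)) / (2 * Real.log n) := by field_simp
  have e3 : H - Real.log σ / (2 * Real.log n) =
      (2 * H * Real.log n - Real.log σ) / (2 * Real.log n) := by field_simp
  rw [e1, e2, e3]
  constructor <;> gcongr <;> linarith

theorem theorem3p1 {Ω : Type*} [MeasurableSpace Ω] (P : Measure Ω) [IsProbabilityMeasure P]
    (B : ℝ≥0 → Ω → ℝ) (H Hstar : ℝ) (hH : 0 < H) (hHs : H ≤ Hstar) (hHs1 : Hstar < 1)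
    (hB : IsFractionalBrownianMotion H B P)
    (n : ℕ) (hn : 1 ≤ n) (a : ℝ) (ha : 0 < a) (ha' : a < (4 - (4 : ℝ) ^ Hstar) * √(n : ℝ)) :
    confidenceLevel n a ≤
      P.real {ω | hurstTransform n H ∈
        Set.Icc (confidenceLeft n Hstar a (secondOrderVariation B n ω))
          (confidenceRight n Hstar a (secondOrderVariation B n ω))} := by
  rcases hn.eq_or_lt with rfl | hn1
  · have h41 : (1 : ℝ) ≤ 4 ^ Hstar := Real.one_le_rpow (by norm_num) (hH.le.trans hHs)
    rw [Nat.cast_one, Real.sqrt_one, mul_one] at ha'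
    rw [confidenceLevel_one ha (by linarith)]
    exact measureReal_nonneg
  refine max_le ?_ measureReal_nonneg
  set E := {ω | hurstTransform n H ∈
        Set.Icc (confidenceLeft n Hstar a (secondOrderVariation B n ω))
          (confidenceRight n Hstar a (secondOrderVariation B n ω))}
  have htail := hB.measureReal_abs_secondOrderVariation_sub_ge_le hH (hHs.trans_lt hHs1) hn ha
  set F := {ω | a * √(n : ℝ) ≤
        |(n : ℝ) ^ (2 * H) * secondOrderVariation B n ω - n * (4 - (4 : ℝ) ^ H)|}
  -- Covering the space and using subadditivity avoids any measurability of `E` or `F`.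
  have hcover : E ∪ F = Set.univ := by
    refine Set.eq_univ_of_forall fun ω => ?_
    by_cases h : ω ∈ F
    · exact Or.inr h
    · exact Or.inl (hurstTransform_mem_Icc hn1 hHs hHs1 ha ha' (not_le.1 h))
  have hone := measureReal_union_le (μ := P) E F
  rw [hcover, probReal_univ] at hone
  linarith
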